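/- Let $V$ be a $(2n+1)$-dimensional complex vector space with a non-degenerate symmetric bilinear form $\beta$ and a basis $e_{-n},\dots,e_n$ such that $\beta(e_i,e_j)=1$ if $i=-j$ and $\beta(e_i,e_j)=0$ otherwise. A subspace of $V$ is isotropic if $\beta$ vanishes identically on it; let $B_n$ be the set of isotropic subspaces of dimension $n$ (the maximal dimension). Let $\mathbb{SY}_n$ be the set of integer sequences $n\ge\lambda_1>\lambda_2>\cdots>\lambda_n\ge -n$ with $\{|\lambda_1|,\dots,|\lambda_n|\}=\{1,\dots,n\}$, write $|\lambda|$ for the sum of the positive $\lambda_j$, and write $\mu\le\lambda$ if $\mu_j\le\lambda_j$ for all $j$. For $\lambda,\mu\in\mathbb{SY}_n$ and an isotropic subspace $K$ of $V$ put $$X_\mu=\{H\in B_n \mid \dim (H\cap\langle e_{\mu_j},\dots,e_n\rangle)\ge j,\ 1\le j\le n\},$$ $$X'_{\lambda^c}=\{H\in B_n \mid \dim (H\cap\langle e_{-n},\dots,e_{\lambda_j}\rangle)\ge n+1-j,\ 1\le j\le n\},$$ $$X_K=\{H\in B_n \mid H\cap K\ne 0\}.$$ Say that $\lambda/\mu$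 is a skew row if $\lambda_1\ge\mu_1\ge\lambda_2\ge\mu_2\ge\cdots\ge\lambda_n\ge\mu_n$. **Theorem.** Let $\mu,\lambda\in\mathbb{SY}_n$ and let $m\ge 0$ be an integer with $|\mu|+m=|\lambda|$ and $m\le n+1$. Then for a general isotropic $(n+1-m)$-plane $K$ in $V$ (that is, for all $K$ in some dense Zariski-open subset of the variety of isotropic $(n+1-m)$-dimensional subspaces of $V$), $$X_\mu\cap X'_{\lambda^c}\cap X_K\ne\emptyset$$ only if $\mu\le\lambda$ and $\lambda/\mu$ is a skew row. -/

import Mathlib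

noncomputable section

namespace OrthGrass

/-! ### The index set of strict sequences -/

/-- Sequences `n ≥ lam₁ > ... > lamₙ ≥ -n` of integers whose set of absolute values is `{1, ..., n}`.
The entries are indexed from `0`, so that `lam j` is the entry number `j + 1`; the bounds
`-n ≤ lam j ≤ n` follow from the condition on the absolute values. -/
structure SY (n : ℕ) where
  /-- the entries of the sequence -/
  entry : Fin n → ℤ
  strictAnti : StrictAnti entry
  range_abs : Set.range (fun j => |entry j|) = Set.Icc 1 (n : ℤ)

instance (n : ℕ) : CoeFun (SY n) (fun _ => Fin n → ℤ) := ⟨SY.entry⟩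

/-- `|lam|`, the sum of the positive entries. -/
def SY.size {n : ℕ} (lam : SY n) : ℤ := ∑ j with 0 < lam j, lam j

/-- The Bruhat order: `mu ≤ lam` when `mu j ≤ lam j` for all `j`. -/
instance (n : ℕ) : LE (SY n) := ⟨fun mu lam => ∀ j, mu j ≤ lam j⟩

/-- `lam/mu` is a skew row: `lam₁ ≥ mu₁ ≥ lam₂ ≥ mu₂ ≥ ... ≥ lamₙ ≥ muₙ`. -/
def IsSkewRow {n : ℕ} (lam mu : SY n) : Prop :=
  (∀ j, mu j ≤ lam j) ∧ ∀ i j : Fin n, (i : ℕ) + 1 = j → lam j ≤ mu i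

/-! ### Isotropic subspaces and Schubert varieties -/

variable {V : Type*} [AddCommGroup V] [Module ℂ V]

/-- The restriction of `β` to `H` is identically zero. -/
def IsIsotropic (β : LinearMap.BilinForm ℂ V) (H : Submodule ℂ V) : Prop :=
  ∀ x ∈ H, ∀ y ∈ H, β x y = 0

/-- The set of isotropic subspaces of dimension `n`. For `dim V = 2n + 1` and `β` nondegenerate
these are the maximal isotropic subspaces. -/
def maxIsotropic (n : ℕ) (β : LinearMap.BilinForm ℂ V) : Set (Submodule ℂ V) :=
  {H | IsIsotropic β H ∧ Module.finrank ℂ H = n}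

/-- A basis `e₋ₙ, ..., eₙ` of `V` with `β(eᵢ, eⱼ) = 1` if `i = -j` and `0` otherwise.
Its existence says that `dim V = 2n + 1` and that `β` is symmetric and nondegenerate. -/
def IsStandardBasis {n : ℕ} (β : LinearMap.BilinForm ℂ V)
    (e : Module.Basis (Set.Icc (-(n : ℤ)) (n : ℤ)) ℂ V) : Prop :=
  ∀ i j, β (e i) (e j) = if (i : ℤ) = -(j : ℤ) then 1 else 0

/-- The span of the `eᵢ` with `a ≤ i ≤ n`. -/
def upperSpan {n : ℕ} (e : Module.Basis (Set.Icc (-(n : ℤ)) (n : ℤ)) ℂ V) (a : ℤ) :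
    Submodule ℂ V :=
  Submodule.span ℂ (e '' {i | a ≤ (i : ℤ)})

/-- The span of the `eᵢ` with `-n ≤ i ≤ a`. -/
def lowerSpan {n : ℕ} (e : Module.Basis (Set.Icc (-(n : ℤ)) (n : ℤ)) ℂ V) (a : ℤ) :
    Submodule ℂ V :=
  Submodule.span ℂ (e '' {i | (i : ℤ) ≤ a})

/-- The Schubert variety `X_mu`: those `H` with `dim H ∩ ⟨e_{mu_j}, ..., e_n⟩ ≥ j` for
`j = 1, ..., n`. -/
def schubert {n : ℕ} (β : LinearMap.BilinForm ℂ V)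
    (e : Module.Basis (Set.Icc (-(n : ℤ)) (n : ℤ)) ℂ V) (mu : SY n) : Set (Submodule ℂ V) :=
  {H | H ∈ maxIsotropic n β ∧
    ∀ j : Fin n, (j : ℕ) + 1 ≤ Module.finrank ℂ (H ⊓ upperSpan e (mu j) : Submodule ℂ V)}

/-- The opposite Schubert variety `X'_{lam^c}`: those `H` with
`dim H ∩ ⟨e_{-n}, ..., e_{lam_j}⟩ ≥ n + 1 - j` for `j = 1, ..., n`. -/
def schubertOppCompl {n : ℕ} (β : LinearMap.BilinForm ℂ V)
    (e : Module.Basis (Set.Icc (-(n : ℤ)) (n : ℤ)) ℂ V) (lam : SY n) : Set (Submodule ℂ V) :=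
  {H | H ∈ maxIsotropic n β ∧
    ∀ j : Fin n, n + 1 - ((j : ℕ) + 1) ≤
      Module.finrank ℂ (H ⊓ lowerSpan e (lam j) : Submodule ℂ V)}

/-- The special Schubert variety `X_K`: the maximal isotropic `H` that meet `K` nontrivially. -/
def specialSchubert (n : ℕ) (β : LinearMap.BilinForm ℂ V) (K : Submodule ℂ V) :
    Set (Submodule ℂ V) :=
  {H | H ∈ maxIsotropic n β ∧ H ⊓ K ≠ ⊥}

/-! ### The Zariski topology on the variety of isotropic `k`-planes -/

/-- The Zariski topology of a finite-dimensional complex vector space `E`: the sets where a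
polynomial in linear forms does not vanish are a basis of the topology. -/
abbrev zariski (E : Type*) [AddCommGroup E] [Module ℂ E] : TopologicalSpace E :=
  TopologicalSpace.generateFrom
    {D | ∃ p : MvPolynomial (Module.Dual ℂ E) ℂ,
      D = {v : E | MvPolynomial.eval (fun l : Module.Dual ℂ E => l v) p ≠ 0}}

/-- The variety of isotropic `k`-planes, as a set. -/
def IsoPlanes (β : LinearMap.BilinForm ℂ V) (k : ℕ) : Type _ :=
  {K : Submodule ℂ V // IsIsotropic β K ∧ Module.finrank ℂ K = k}

/-- The isotropic `k`-frames: bases of isotropic `k`-planes, a subset of `V ^ k`. -/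
def IsoFrames (β : LinearMap.BilinForm ℂ V) (k : ℕ) : Type _ :=
  {v : Fin k → V // LinearIndependent ℂ v ∧ IsIsotropic β (Submodule.span ℂ (Set.range v))}

/-- The `k`-plane spanned by a frame. -/
def IsoFrames.toPlane {β : LinearMap.BilinForm ℂ V} {k : ℕ} (v : IsoFrames β k) :
    IsoPlanes β k :=
  ⟨Submodule.span ℂ (Set.range v.1), v.2.2, by
    rw [finrank_span_eq_card v.2.1, Fintype.card_fin]⟩

/-- The Zariski topology on isotropic frames, as a subspace of the vector space `V ^ k`. -/
instance (β : LinearMap.BilinForm ℂ V) (k : ℕ) : TopologicalSpace (IsoFrames β k) :=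
  TopologicalSpace.induced Subtype.val (zariski (Fin k → V))

/-- The Zariski topology on isotropic `k`-planes: the quotient topology of the one on frames,
under the action of `GL_k` by change of frame. -/
instance (β : LinearMap.BilinForm ℂ V) (k : ℕ) : TopologicalSpace (IsoPlanes β k) :=
  TopologicalSpace.coinduced IsoFrames.toPlane inferInstance

/-- `P K` holds for a general isotropic `k`-plane `K`, i.e. for all `K` in some dense Zariski-open
subset of the variety of isotropic `k`-planes. -/
def ForGeneralIsoPlane (β : LinearMap.BilinForm ℂ V) (k : ℕ) (P : Submodule ℂ V → Prop) : Prop :=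
  ∃ U : Set (IsoPlanes β k), IsOpen U ∧ Dense U ∧ ∀ K ∈ U, P K.1

end OrthGrass

end

/-!
A maximal isotropic `H` in `X_mu ∩ X'_{lam^c}` has, for each `j`, intersections with
`⟨e_{mu_j}, ..., e_n⟩` and `⟨e_{-n}, ..., e_{lam_j}⟩` whose dimensions add up to more than `n`, so
these two spaces meet and `mu ≤ lam` (`le_of_mem_schubert`).

For `1 ≤ i ≤ n` let `q_i(x) = ∑_{l ≥ i} x_l x_{-l}` (`cutForm`). Call `i` a cut if `lam` and `mu`
have equally many entries `≥ i`. At a cut, `H` is the direct sum of its intersections with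
`⟨e_i, ..., e_n⟩` and `⟨e_{-n}, ..., e_{i-1}⟩`, and isotropy of `H` makes `q_i` vanish on `H`
(`cutForm_eq_zero_of_mem_schubert`). The numbers of entries `≥ i` in `lam` exceed those in `mu` by
amounts that add up to `|lam| - |mu| = m`. If `lam/mu` is not a skew row, one of these amounts is at
least `2`, so there are at least `n + 1 - m = k` cuts (`le_card_cuts`).

It remains to see that a general isotropic `k`-plane `K` meets the common zero locus of `k` or more
of the forms `q_i` only at the origin.

* One such plane exists (`exists_isoFrame_forall_cutForm`): there is an isotropic `n`-plane with
  coordinates `z_1, ..., z_n` on which `q_i = -z_i² / 2` for all `i`, and `K` is a coordinate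
  subspace of it.
* The condition is open (`isOpen_forall_cutForm`): by the Nullstellensatz, forms without a common
  zero but the origin generate all monomials of some degree, and the nonvanishing of a determinant
  of coefficients keeps this true nearby (`exists_elimination`).
* Nonempty open sets of isotropic planes are dense (`dense_of_isOpen`): Siegel transformations
  `x ↦ x + β(x,a) b - β(x,b) a - β(b,b)/2 β(x,a) a` lie on polynomial curves `b ↦ t b` through the
  identity, so they preserve the closure of an open set, and they act transitively on isotropic
  planes of a given dimension (`SiegelStable.mem_of_mem`).
-/

namespace OrthGrass

section

/-! ### Counting entries of strict sequences -/

/-- The number of entries of `lam` that are at least `a`. -/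
def SY.countGE {n : ℕ} (lam : SY n) (a : ℤ) : ℕ := (Finset.univ.filter fun j => a ≤ lam j).card

theorem SY.lt_countGE_iff {n : ℕ} (lam : SY n) (a : ℤ) (j : Fin n) :
    (j : ℕ) < lam.countGE a ↔ a ≤ lam j := by
  constructor
  · intro h
    by_contra! hlt
    have hsub : (Finset.univ.filter fun i => a ≤ lam i) ⊆ Finset.Iio j := by
      intro i hi
      rw [Finset.mem_filter] at hi
      exact Finset.mem_Iio.2 (lam.strictAnti.lt_iff_gt.1 (hlt.trans_le hi.2))
    have := Finset.card_le_card hsub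
    rw [Fin.card_Iio] at this
    exact absurd h (not_lt.2 this)
  · intro h
    have hsub : Finset.Iic j ⊆ (Finset.univ.filter fun i => a ≤ lam i) := by
      intro i hi
      rw [Finset.mem_filter]
      exact ⟨Finset.mem_univ _, h.trans (lam.strictAnti.antitone (Finset.mem_Iic.1 hi))⟩
    have := Finset.card_le_card hsub
    rw [Fin.card_Iic] at this
    exact this

theorem SY.countGE_le {n : ℕ} (lam : SY n) (a : ℤ) : lam.countGE a ≤ n :=
  (Finset.card_le_univ _).trans_eq (Fintype.card_fin n)

theorem SY.countGE_mono {n : ℕ} {mu lam : SY n} (h : ∀ j, mu j ≤ lam j) (a : ℤ) :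
    mu.countGE a ≤ lam.countGE a :=
  Finset.card_le_card fun j hj => by
    rw [Finset.mem_filter] at hj ⊢
    exact ⟨hj.1, hj.2.trans (h j)⟩

theorem SY.image_abs {n : ℕ} (lam : SY n) :
    Finset.univ.image (fun j => |lam j|) = Finset.Icc 1 (n : ℤ) := by
  ext x
  have := Set.ext_iff.1 lam.range_abs x
  simpa using this

theorem SY.abs_injective {n : ℕ} (lam : SY n) : Function.Injective fun j => |lam j| := by
  rw [← Set.injOn_univ, ← Finset.coe_univ, ← Finset.card_image_iff, lam.image_abs]
  simp

theorem SY.abs_mem {n : ℕ} (lam : SY n) (j : Fin n) : 1 ≤ |lam j| ∧ |lam j| ≤ n := by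
  have : |lam j| ∈ Finset.Icc 1 (n : ℤ) := lam.image_abs ▸
    Finset.mem_image_of_mem _ (Finset.mem_univ j)
  exact Finset.mem_Icc.1 this

/-- Exactly one of `i` and `-i` is an entry of `lam` for `1 ≤ i ≤ n`, so the numbers of entries
`≥ 1 - a` and `≥ a` differ by `a - 1`. -/
theorem SY.countGE_one_sub {n : ℕ} (lam : SY n) {a : ℤ} (h1 : 1 ≤ a) (hn : a ≤ n + 1) :
    (lam.countGE (1 - a) : ℤ) = lam.countGE a + (a - 1) := by
  have hcard : (Finset.univ.filter fun j => |lam j| ≤ a - 1).card =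
      (Finset.Icc 1 (a - 1)).card := by
    rw [← Finset.card_image_of_injective _ lam.abs_injective]
    congr 1
    ext x
    have hx := Finset.ext_iff.1 lam.image_abs x
    simp only [Finset.mem_image, Finset.mem_filter, Finset.mem_univ, true_and, Finset.mem_Icc]
      at hx ⊢
    constructor
    · rintro ⟨j, hj, rfl⟩
      exact ⟨(lam.abs_mem j).1, hj⟩
    · intro h
      obtain ⟨j, hj⟩ := hx.2 ⟨h.1, by linarith [h.2]⟩
      exact ⟨j, hj ▸ h.2, hj⟩
  have hunion : (Finset.univ.filter fun j => 1 - a ≤ lam j) =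
      (Finset.univ.filter fun j => a ≤ lam j) ∪ (Finset.univ.filter fun j => |lam j| ≤ a - 1) := by
    ext j
    simp only [Finset.mem_filter, Finset.mem_univ, true_and, Finset.mem_union, abs_le]
    omega
  have hdisj : Disjoint (Finset.univ.filter fun j => a ≤ lam j)
      (Finset.univ.filter fun j => |lam j| ≤ a - 1) := by
    rw [Finset.disjoint_filter]
    intro j _ h h'
    rw [abs_le] at h'
    omega
  rw [SY.countGE, hunion, Finset.card_union_of_disjoint hdisj, hcard, Int.card_Icc, SY.countGE]
  push_cast
  omega

theorem SY.size_eq_sum_countGE {n : ℕ} (lam : SY n) :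
    lam.size = ∑ i ∈ Finset.Icc 1 (n : ℤ), (lam.countGE i : ℤ) := by
  simp only [SY.countGE, Finset.card_filter, Nat.cast_sum, SY.size]
  rw [Finset.sum_comm, Finset.sum_filter]
  refine Finset.sum_congr rfl fun j _ => ?_
  have hle : lam j ≤ n := (le_abs_self _).trans (lam.abs_mem j).2
  have : (Finset.Icc 1 (n : ℤ)).filter (fun i => i ≤ lam j) = Finset.Icc 1 (lam j) := by
    ext i
    simp only [Finset.mem_filter, Finset.mem_Icc]
    omega
  rw [← Nat.cast_sum, ← Finset.card_filter, this, Int.card_Icc]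
  split_ifs <;> omega

/-- The cuts of `lam/mu`: the `i` in `1, ..., n` such that `lam` and `mu` have equally many entries
that are at least `i`. -/
noncomputable def cuts {n : ℕ} (lam mu : SY n) : Finset ℤ :=
  (Finset.Icc 1 (n : ℤ)).filter fun i => lam.countGE i = mu.countGE i

/-- If `lam/mu` is not a skew row, then some `i > 0` has two more entries `≥ i` in `lam` than in
`mu`. -/
theorem exists_countGE_add_two_le {n : ℕ} {lam mu : SY n} (hle : ∀ j, mu j ≤ lam j)
    (hrow : ¬ IsSkewRow lam mu) :
    ∃ i ∈ Finset.Icc 1 (n : ℤ), mu.countGE i + 2 ≤ lam.countGE i := by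
  simp only [IsSkewRow, not_and, not_forall, not_le] at hrow
  obtain ⟨i, j, hij, hlt⟩ := hrow hle
  have h1 : (j : ℕ) < lam.countGE (lam j) := (lam.lt_countGE_iff _ _).2 le_rfl
  have h2 : mu.countGE (lam j) ≤ i := not_lt.1 fun h => not_le.2 hlt ((mu.lt_countGE_iff _ _).1 h)
  have habs := lam.abs_mem j
  have habs' := mu.abs_mem i
  rcases le_or_gt 1 (lam j) with hpos | hneg
  · exact ⟨lam j, Finset.mem_Icc.2 ⟨hpos, (le_abs_self _).trans habs.2⟩, by omega⟩
  · -- By symmetry the surplus at `lam j ≤ -1` equals the one at `1 - lam j`.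
    have hbound : 1 - lam j ≤ n := by
      have := neg_abs_le (mu i)
      omega
    have e1 := lam.countGE_one_sub (a := 1 - lam j) (by omega) (by omega)
    have e2 := mu.countGE_one_sub (a := 1 - lam j) (by omega) (by omega)
    rw [sub_sub_cancel] at e1 e2
    exact ⟨1 - lam j, Finset.mem_Icc.2 ⟨by omega, hbound⟩, by omega⟩

/-- The surpluses of `lam` over `mu` at `1, ..., n` add up to `m`, and one of them is at least `2`,
so at most `m - 1` of them are nonzero. -/
theorem le_card_cuts {n k m : ℕ} {lam mu : SY n} (hm : mu.size + (m : ℤ) = lam.size)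
    (hk : k + m = n + 1) (hle : ∀ j, mu j ≤ lam j) (hrow : ¬ IsSkewRow lam mu) :
    k ≤ (cuts lam mu).card := by
  obtain ⟨i, hi, h2⟩ := exists_countGE_add_two_le hle hrow
  set I := Finset.Icc 1 (n : ℤ) with hI
  have hsum : (m : ℤ) = ∑ a ∈ I, ((lam.countGE a : ℤ) - mu.countGE a) := by
    rw [Finset.sum_sub_distrib, ← lam.size_eq_sum_countGE, ← mu.size_eq_sum_countGE]
    omega
  have hcard : (cuts lam mu).card +
      (I.filter fun a => ¬ lam.countGE a = mu.countGE a).card = n := by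
    rw [cuts, Finset.card_filter_add_card_filter_not]
    simp
  have hlt : (I.filter fun a => ¬ lam.countGE a = mu.countGE a).card <
      ∑ a ∈ I, ((lam.countGE a : ℤ) - mu.countGE a) := by
    rw [Finset.card_filter]
    push_cast
    refine Finset.sum_lt_sum (fun a _ => ?_) ⟨i, hi, ?_⟩
    · have := SY.countGE_mono hle a
      split_ifs <;> omega
    · split_ifs <;> omega
  omega

/-! ### Coordinates with respect to a standard basis -/

variable {V : Type*} [AddCommGroup V] [Module ℂ V] {n : ℕ}
  (e : Module.Basis (Set.Icc (-(n : ℤ)) (n : ℤ)) ℂ V)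

/-- The coefficient of `e_l`, as a linear form. It is defined to be `0` for `|l| > n`. -/
noncomputable def coordAt (l : ℤ) : V →ₗ[ℂ] ℂ :=
  if h : l ∈ Set.Icc (-(n : ℤ)) (n : ℤ) then e.coord ⟨l, h⟩ else 0

theorem coordAt_of_mem {l : ℤ} (h : l ∈ Set.Icc (-(n : ℤ)) (n : ℤ)) (x : V) :
    coordAt e l x = e.repr x ⟨l, h⟩ := by
  rw [coordAt, dif_pos h, Module.Basis.coord_apply]

theorem coordAt_basis (l : ℤ) (i : Set.Icc (-(n : ℤ)) (n : ℤ)) :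
    coordAt e l (e i) = if l = i then 1 else 0 := by
  by_cases h : l ∈ Set.Icc (-(n : ℤ)) (n : ℤ)
  · rw [coordAt_of_mem e h, e.repr_self, Finsupp.single_apply]
    exact if_congr (by rw [Subtype.ext_iff, eq_comm]) rfl rfl
  · rw [coordAt, dif_neg h, if_neg (fun hl : l = i => h (hl ▸ i.2))]
    rfl

theorem eq_zero_of_coordAt {x : V} (h : ∀ l, coordAt e l x = 0) : x = 0 := by
  refine e.repr.map_eq_zero_iff.1 (Finsupp.ext fun i => ?_)
  rw [← coordAt_of_mem e i.2, h, Finsupp.zero_apply]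

theorem coordAt_upperSpan {a l : ℤ} (hl : l < a) {x : V} (hx : x ∈ upperSpan e a) :
    coordAt e l x = 0 := by
  have : upperSpan e a ≤ LinearMap.ker (coordAt e l) := by
    refine Submodule.span_le.2 ?_
    rintro _ ⟨i, hi, rfl⟩
    change coordAt e l (e i) = 0
    rw [coordAt_basis, if_neg (ne_of_lt (hl.trans_le hi))]
  exact this hx

theorem coordAt_lowerSpan {a l : ℤ} (hl : a < l) {x : V} (hx : x ∈ lowerSpan e a) :
    coordAt e l x = 0 := by
  have : lowerSpan e a ≤ LinearMap.ker (coordAt e l) := by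
    refine Submodule.span_le.2 ?_
    rintro _ ⟨i, hi, rfl⟩
    change coordAt e l (e i) = 0
    rw [coordAt_basis, if_neg (ne_of_gt (hl.trans_le' hi))]
  exact this hx

theorem upperSpan_inf_lowerSpan {a b : ℤ} (h : b < a) : upperSpan e a ⊓ lowerSpan e b = ⊥ := by
  rw [eq_bot_iff]
  rintro x ⟨hx, hx'⟩
  refine (Submodule.mem_bot ℂ).2 (eq_zero_of_coordAt e fun l => ?_)
  rcases lt_or_ge l a with hl | hl
  · exact coordAt_upperSpan e hl hx
  · exact coordAt_lowerSpan e (h.trans_le hl) hx'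

theorem upperSpan_anti {a b : ℤ} (h : a ≤ b) : upperSpan e b ≤ upperSpan e a :=
  Submodule.span_mono (Set.image_mono fun _ hi => h.trans hi)

theorem lowerSpan_mono {a b : ℤ} (h : a ≤ b) : lowerSpan e a ≤ lowerSpan e b :=
  Submodule.span_mono (Set.image_mono fun _ hi => le_trans hi h)

variable {e} {β : LinearMap.BilinForm ℂ V}

theorem IsStandardBasis.apply_eq_sum (he : IsStandardBasis β e) (x y : V) :
    β x y = ∑ l ∈ Finset.Icc (-(n : ℤ)) n, coordAt e l x * coordAt e (-l) y := by
  have key : β = ∑ l ∈ Finset.Icc (-(n : ℤ)) n,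
      (coordAt e l).smulRight (coordAt e (-l)) := by
    refine e.ext fun i => e.ext fun j => ?_
    rw [he i j, LinearMap.sum_apply, LinearMap.sum_apply, Finset.sum_eq_single (i : ℤ)]
    · rw [LinearMap.smulRight_apply, coordAt_basis, if_pos rfl, one_smul, coordAt_basis]
      exact if_congr neg_eq_iff_eq_neg.symm rfl rfl
    · intro l _ hl
      rw [LinearMap.smulRight_apply, coordAt_basis, if_neg hl, zero_smul, LinearMap.zero_apply]
    · intro hi
      exact absurd (Finset.mem_Icc.2 i.2) hi
  conv_lhs => rw [key]
  simp only [LinearMap.sum_apply, LinearMap.smulRight_apply, LinearMap.smul_apply, smul_eq_mul]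

theorem IsStandardBasis.symm (he : IsStandardBasis β e) (x y : V) : β x y = β y x := by
  rw [he.apply_eq_sum, he.apply_eq_sum]
  refine Finset.sum_nbij' (fun l => -l) (fun l => -l) ?_ ?_ ?_ ?_ ?_
  · intro l hl; rw [Finset.mem_Icc] at *; omega
  · intro l hl; rw [Finset.mem_Icc] at *; omega
  · intro l _; exact neg_neg l
  · intro l _; exact neg_neg l
  · intro l _; rw [neg_neg, mul_comm]

theorem IsStandardBasis.nondegenerate (he : IsStandardBasis β e) : β.Nondegenerate := by
  refine (LinearMap.BilinForm.isSymm_def.2 he.symm).isRefl.nondegenerate_iff_separatingLeft.2 ?_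
  intro x hx
  refine eq_zero_of_coordAt e fun l => ?_
  by_cases h : l ∈ Set.Icc (-(n : ℤ)) (n : ℤ)
  · have hneg : -l ∈ Set.Icc (-(n : ℤ)) (n : ℤ) := ⟨by linarith [h.2], by linarith [h.1]⟩
    have := hx (e ⟨-l, hneg⟩)
    rw [he.apply_eq_sum, Finset.sum_eq_single l] at this
    · rwa [coordAt_basis, if_pos rfl, mul_one] at this
    · intro i _ hi
      rw [coordAt_basis, if_neg (by simpa using hi), mul_zero]
    · intro hl
      exact absurd (Finset.mem_Icc.2 h) hl
  · rw [coordAt, dif_neg h, LinearMap.zero_apply]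


end

section

variable {V : Type*} [AddCommGroup V] [Module ℂ V] {n : ℕ}
  (e : Module.Basis (Set.Icc (-(n : ℤ)) (n : ℤ)) ℂ V)

/-! ### The quadratic forms of the cuts -/

/-- The quadratic form `∑_{l ≥ i} x_l x_{-l}`. -/
noncomputable def cutForm (i : ℤ) (x : V) : ℂ :=
  ∑ l ∈ Finset.Icc i (n : ℤ), coordAt e l x * coordAt e (-l) x

variable {e} {β : LinearMap.BilinForm ℂ V}

theorem IsStandardBasis.apply_self (he : IsStandardBasis β e) (x : V) :
    β x x = coordAt e 0 x ^ 2 + 2 * cutForm e 1 x := by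
  rw [he.apply_eq_sum, cutForm]
  have hsplit : Finset.Icc (-(n : ℤ)) n =
      insert 0 ((Finset.Icc 1 (n : ℤ)).image (fun l => -l) ∪ Finset.Icc 1 (n : ℤ)) := by
    ext l
    simp only [Finset.mem_insert, Finset.mem_union, Finset.mem_image, Finset.mem_Icc]
    constructor
    · intro h
      rcases lt_trichotomy l 0 with hl | hl | hl
      · exact Or.inr (Or.inl ⟨-l, by omega, by omega⟩)
      · exact Or.inl hl
      · exact Or.inr (Or.inr (by omega))
    · rintro (h | ⟨a, h, rfl⟩ | h) <;> omega
  rw [hsplit, Finset.sum_insert, Finset.sum_union, Finset.sum_image neg_injective.injOn]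
  · simp only [neg_neg, neg_zero, mul_comm (coordAt e (-_) x)]
    ring
  · rw [Finset.disjoint_left]
    simp only [Finset.mem_image, Finset.mem_Icc]
    rintro l ⟨a, h, rfl⟩
    omega
  · simp only [Finset.mem_union, Finset.mem_image, Finset.mem_Icc]
    rintro (⟨a, h, h'⟩ | h) <;> omega

/-- If a sum of dimensions forces an isotropic `H` to be the sum of its intersections with
`⟨e_i, ..., e_n⟩` and `⟨e_{-n}, ..., e_{i-1}⟩`, then the form `∑_{l ≥ i} x_l x_{-l}` vanishes
on `H`: it is the pairing of `x` with its component `∑_{l ≥ i} x_l e_l`. -/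
theorem cutForm_eq_zero (he : IsStandardBasis β e) {H : Submodule ℂ V} (hH : IsIsotropic β H)
    {i : ℤ} (hi : -(n : ℤ) ≤ i) (hdim : Module.finrank ℂ H ≤
      Module.finrank ℂ (H ⊓ upperSpan e i : Submodule ℂ V) +
        Module.finrank ℂ (H ⊓ lowerSpan e (i - 1) : Submodule ℂ V))
    {x : V} (hx : x ∈ H) : cutForm e i x = 0 := by
  have := Module.Finite.of_basis e
  have hinf : (H ⊓ upperSpan e i) ⊓ (H ⊓ lowerSpan e (i - 1)) = ⊥ := by
    rw [← inf_inf_distrib_left, upperSpan_inf_lowerSpan e (by omega), inf_bot_eq]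
  have hsup : (H ⊓ upperSpan e i) ⊔ (H ⊓ lowerSpan e (i - 1)) = H := by
    refine Submodule.eq_of_le_of_finrank_le (sup_le inf_le_left inf_le_left) ?_
    have := Submodule.finrank_sup_add_finrank_inf_eq (H ⊓ upperSpan e i) (H ⊓ lowerSpan e (i - 1))
    rw [hinf, finrank_bot] at this
    omega
  obtain ⟨f, hf, g, hg, rfl⟩ := Submodule.mem_sup.1 (hsup.symm ▸ hx)
  rw [← hH f hf.1 _ hx, he.apply_eq_sum, cutForm]
  have hsub : Finset.Icc i (n : ℤ) ⊆ Finset.Icc (-(n : ℤ)) n := Finset.Icc_subset_Icc_left hi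
  rw [← Finset.sum_subset hsub fun l hl hl' => ?_]
  · refine Finset.sum_congr rfl fun l hl => ?_
    rw [map_add (coordAt e l), coordAt_lowerSpan e (by linarith [(Finset.mem_Icc.1 hl).1]) hg.2,
      add_zero]
  · rw [coordAt_upperSpan e ?_ hf.2, zero_mul]
    rw [Finset.mem_Icc] at hl hl'
    omega

/-! ### Maximal isotropic subspaces in an intersection of Schubert varieties -/

theorem le_of_mem_schubert {lam mu : SY n} {H : Submodule ℂ V}
    (h1 : H ∈ schubert β e mu) (h2 : H ∈ schubertOppCompl β e lam) (j : Fin n) :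
    mu j ≤ lam j := by
  have := Module.Finite.of_basis e
  by_contra! hlt
  have hinf : (H ⊓ upperSpan e (mu j)) ⊓ (H ⊓ lowerSpan e (lam j)) = ⊥ := by
    rw [← inf_inf_distrib_left, upperSpan_inf_lowerSpan e hlt, inf_bot_eq]
  have hsum := Submodule.finrank_sup_add_finrank_inf_eq
    (H ⊓ upperSpan e (mu j)) (H ⊓ lowerSpan e (lam j))
  have hle : Module.finrank ℂ ((H ⊓ upperSpan e (mu j)) ⊔ (H ⊓ lowerSpan e (lam j)) :
      Submodule ℂ V) ≤ Module.finrank ℂ H :=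
    Submodule.finrank_mono (sup_le inf_le_left inf_le_left)
  rw [hinf, finrank_bot] at hsum
  have a1 := h1.2 j
  have a2 := h2.2 j
  have a3 := h1.1.2
  omega

theorem cutForm_eq_zero_of_mem_schubert (he : IsStandardBasis β e) {lam mu : SY n}
    {H : Submodule ℂ V} (h1 : H ∈ schubert β e mu) (h2 : H ∈ schubertOppCompl β e lam)
    {i : ℤ} (hi : i ∈ cuts lam mu) {x : V} (hx : x ∈ H) : cutForm e i x = 0 := by
  have := Module.Finite.of_basis e
  rw [cuts, Finset.mem_filter, Finset.mem_Icc] at hi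
  refine cutForm_eq_zero he h1.1.1 (by omega) ?_ hx
  rw [h1.1.2]
  have hup : mu.countGE i ≤ Module.finrank ℂ (H ⊓ upperSpan e i : Submodule ℂ V) := by
    rcases Nat.eq_zero_or_pos (mu.countGE i) with h0 | h0
    · omega
    · have hlt : mu.countGE i - 1 < n := by
        have := mu.countGE_le i
        omega
      have hent : i ≤ mu ⟨_, hlt⟩ := (mu.lt_countGE_iff i ⟨_, hlt⟩).1 (Nat.sub_lt h0 one_pos)
      have hmono : Module.finrank ℂ (H ⊓ upperSpan e (mu ⟨_, hlt⟩) : Submodule ℂ V) ≤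
          Module.finrank ℂ (H ⊓ upperSpan e i : Submodule ℂ V) :=
        Submodule.finrank_mono (inf_le_inf_left H (upperSpan_anti e hent))
      have := h1.2 ⟨_, hlt⟩
      simp only at this
      omega
  have hlow : n - lam.countGE i ≤
      Module.finrank ℂ (H ⊓ lowerSpan e (i - 1) : Submodule ℂ V) := by
    rcases (lam.countGE_le i).eq_or_lt with h0 | hlt
    · omega
    · have hent : lam ⟨_, hlt⟩ ≤ i - 1 := by
        have := (lam.lt_countGE_iff i ⟨_, hlt⟩).not.1 (lt_irrefl _)
        omega
      have hmono : Module.finrank ℂ (H ⊓ lowerSpan e (lam ⟨_, hlt⟩) : Submodule ℂ V) ≤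
          Module.finrank ℂ (H ⊓ lowerSpan e (i - 1) : Submodule ℂ V) :=
        Submodule.finrank_mono (inf_le_inf_left H (lowerSpan_mono e hent))
      have := h2.2 ⟨_, hlt⟩
      simp only at this
      omega
  have := hi.2
  omega

/-! ### An isotropic plane on which the forms of the cuts are independent squares -/

/-- The coordinates of the vector `squareVector e z`. -/
noncomputable def squareCoord (z : ℤ → ℂ) (l : ℤ) : ℂ :=
  if 0 < l then z l - z (l + 1) else if l = 0 then -z 1 else -(z (-l) + z (-l + 1)) / 2

variable (e) in
/-- The vector with coordinates `z_l - z_{l+1}` at `l`, `-(z_l + z_{l+1})/2` at `-l`, for `l > 0`,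
and `-z_1` at `0`. The products of its coordinates at `l` and `-l` telescope, which turns the form
`∑_{l ≥ i} x_l x_{-l}` into `-z_i² / 2` if `z_{n+1} = 0`. -/
noncomputable def squareVector : (ℤ → ℂ) →ₗ[ℂ] V where
  toFun z := ∑ i : Set.Icc (-(n : ℤ)) (n : ℤ), squareCoord z i • e i
  map_add' y z := by
    rw [← Finset.sum_add_distrib]
    refine Finset.sum_congr rfl fun i _ => ?_
    rw [← add_smul]
    congr 1
    simp only [squareCoord, Pi.add_apply]
    split_ifs <;> ring
  map_smul' c z := by
    rw [Finset.smul_sum]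
    refine Finset.sum_congr rfl fun i _ => ?_
    rw [smul_smul]
    congr 1
    simp only [squareCoord, Pi.smul_apply, smul_eq_mul, RingHom.id_apply]
    split_ifs <;> ring

theorem coordAt_squareVector (z : ℤ → ℂ) {l : ℤ} (h : l ∈ Set.Icc (-(n : ℤ)) (n : ℤ)) :
    coordAt e l (squareVector e z) = squareCoord z l := by
  change coordAt e l (∑ i : Set.Icc (-(n : ℤ)) (n : ℤ), squareCoord z i • e i) = _
  rw [map_sum, Finset.sum_eq_single ⟨l, h⟩]
  · rw [map_smul, coordAt_basis, if_pos rfl, smul_eq_mul, mul_one]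
  · intro i _ hi
    rw [map_smul, coordAt_basis, if_neg (fun hl : l = i => hi (Subtype.ext hl.symm)), smul_zero]
  · exact fun h => absurd (Finset.mem_univ _) h

theorem sum_Icc_int_sub {M : Type*} [AddCommGroup M] (f : ℤ → M) {a b : ℤ} (h : a ≤ b + 1) :
    ∑ l ∈ Finset.Icc a b, (f l - f (l + 1)) = f a - f (b + 1) := by
  obtain ⟨d, hd⟩ := Int.le.dest h
  obtain rfl : b = a + d - 1 := by omega
  clear h hd
  induction d with
  | zero => simp
  | succ d ih =>
    have : Finset.Icc a (a + ((d + 1 : ℕ) : ℤ) - 1) =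
        insert (a + d) (Finset.Icc a (a + (d : ℤ) - 1)) := by
      ext l
      simp only [Finset.mem_insert, Finset.mem_Icc]
      omega
    rw [this, Finset.sum_insert (by simp), ih]
    simp only [Nat.cast_succ, sub_add_cancel, ← add_assoc]
    abel

theorem cutForm_squareVector {z : ℤ → ℂ} (hz : z (n + 1) = 0) {i : ℤ} (h1 : 1 ≤ i)
    (hn : i ≤ n + 1) : cutForm e i (squareVector e z) = -z i ^ 2 / 2 := by
  have : ∀ l ∈ Finset.Icc i (n : ℤ), coordAt e l (squareVector e z) *
      coordAt e (-l) (squareVector e z) = (-z l ^ 2 / 2) - (-z (l + 1) ^ 2 / 2) := by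
    intro l hl
    rw [Finset.mem_Icc] at hl
    rw [coordAt_squareVector z ⟨by omega, by omega⟩, coordAt_squareVector z ⟨by omega, by omega⟩,
      squareCoord, squareCoord, if_pos (by omega), if_neg (by omega), if_neg (by omega), neg_neg]
    ring
  rw [cutForm, Finset.sum_congr rfl this, sum_Icc_int_sub (fun l => -z l ^ 2 / 2) hn, hz]
  simp

theorem squareVector_isotropic (he : IsStandardBasis β e) {z : ℤ → ℂ} (hz : z (n + 1) = 0) :
    β (squareVector e z) (squareVector e z) = 0 := by
  rw [he.apply_self, cutForm_squareVector hz le_rfl (by omega),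
    coordAt_squareVector z ⟨by omega, by omega⟩, squareCoord, if_neg (lt_irrefl _), if_pos rfl]
  ring

theorem isIsotropic_of_apply_self (hs : ∀ x y, β x y = β y x) {H : Submodule ℂ V}
    (h : ∀ x ∈ H, β x x = 0) : IsIsotropic β H := by
  intro x hx y hy
  have := h _ (H.add_mem hx hy)
  simp only [map_add, LinearMap.add_apply, h x hx, h y hy, hs y x] at this
  have h2 : 2 * β x y = 0 := by linear_combination this
  exact (mul_eq_zero.1 h2).resolve_left two_ne_zero

theorem exists_isoFrame_forall_cutForm (he : IsStandardBasis β e) {I : Finset ℤ}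
    (hI : I ⊆ Finset.Icc 1 (n : ℤ)) {k : ℕ} (hk : k ≤ I.card) :
    ∃ v : IsoFrames β k, ∀ x ∈ v.toPlane.1, (∀ i ∈ I, cutForm e i x = 0) → x = 0 := by
  classical
  obtain ⟨s⟩ : Nonempty (Fin k ↪ I) :=
    Function.Embedding.nonempty_of_card_le (by simpa using hk)
  let z : (Fin k → ℂ) → ℤ → ℂ := fun c => ∑ t, c t • Pi.single (s t : ℤ) 1
  have hzs : ∀ c t, z c (s t) = c t := by
    intro c t
    simp only [z, Finset.sum_apply, Pi.smul_apply, Pi.single_apply, smul_eq_mul, mul_ite, mul_one,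
      mul_zero]
    rw [Finset.sum_eq_single t, if_pos rfl]
    · intro t' _ ht
      rw [if_neg]
      exact fun h => ht (s.injective (Subtype.ext h)).symm
    · exact fun h => absurd (Finset.mem_univ _) h
  have hz : ∀ c, z c (n + 1) = 0 := by
    intro c
    simp only [z, Finset.sum_apply, Pi.smul_apply, Pi.single_apply, smul_eq_mul, mul_ite, mul_one,
      mul_zero]
    refine Finset.sum_eq_zero fun t _ => if_neg ?_
    have := (Finset.mem_Icc.1 (hI (s t).2)).2
    omega
  let u : Fin k → V := fun t => squareVector e (Pi.single (s t : ℤ) 1)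
  have hu : ∀ c : Fin k → ℂ, ∑ t, c t • u t = squareVector e (z c) := by
    intro c
    simp only [z, u, map_sum, map_smul]
  have hzero : ∀ c : Fin k → ℂ, (∀ i ∈ I, cutForm e i (squareVector e (z c)) = 0) → c = 0 := by
    intro c hc
    ext t
    have hmem := Finset.mem_Icc.1 (hI (s t).2)
    have := hc _ (s t).2
    rw [cutForm_squareVector (hz c) hmem.1 (by omega), hzs] at this
    simpa using this
  refine ⟨⟨u, Fintype.linearIndependent_iff.2 fun c hc => ?_,
    isIsotropic_of_apply_self he.symm fun x hx => ?_⟩, fun x hx hq => ?_⟩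
  · rw [hu] at hc
    refine congrFun (hzero c fun i _ => ?_)
    simp [hc, cutForm]
  · obtain ⟨c, rfl⟩ := (Submodule.mem_span_range_iff_exists_fun ℂ).1 hx
    rw [hu]
    exact squareVector_isotropic he (hz c)
  · obtain ⟨c, rfl⟩ := (Submodule.mem_span_range_iff_exists_fun ℂ).1 hx
    have := hzero c (by simpa only [← hu] using hq)
    simp [this]

end

section

/-! ### Elimination -/

open MvPolynomial in
/-- If finitely many forms over a field `K` of degree `d` have no common zero but the origin, then
every monomial of a suitable degree is a combination of them with homogeneous coefficients. -/
theorem exists_homogeneous_combination {K σ ι : Type*} [Field K] [IsAlgClosed K] [Fintype σ]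
    [Fintype ι] (F : ι → MvPolynomial σ K) (d : ℕ) (hF : ∀ i, (F i).IsHomogeneous d)
    (h0 : ∀ c : σ → K, (∀ i, eval c (F i) = 0) → c = 0) :
    ∃ D : ℕ, ∀ b : σ →₀ ℕ, b.degree = D + d → ∃ g : ι → MvPolynomial σ K,
      (∀ i, (g i).IsHomogeneous D) ∧ ∑ i, g i * F i = monomial b 1 := by
  classical
  set I : Ideal (MvPolynomial σ K) := Ideal.span (Set.range F) with hI
  have hX : ∀ j : σ, ∃ N : ℕ, X j ^ N ∈ I := by
    intro j
    have : X j ∈ I.radical := by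
      rw [← vanishingIdeal_zeroLocus_eq_radical (K := K)]
      intro c hc
      have : c = 0 := h0 c fun i => hc _ (Ideal.subset_span ⟨i, rfl⟩)
      simp [this]
    exact this
  choose N hN using hX
  -- A monomial whose degree exceeds `∑ j, N j` is divisible by some `X j ^ N j`.
  refine ⟨∑ j, N j + 1, fun b hb => ?_⟩
  have hj : ∃ j, N j ≤ b j := by
    by_contra! hlt
    have h1 : b.degree ≤ ∑ j, N j := by
      rw [Finsupp.degree_eq_sum]
      exact Finset.sum_le_sum fun j _ => (hlt j).le
    omega
  obtain ⟨j, hj⟩ := hj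
  have hmem : monomial b (1 : K) ∈ I := by
    have : monomial b (1 : K) = monomial (b - Finsupp.single j (N j)) 1 * X j ^ N j := by
      rw [X_pow_eq_monomial, monomial_mul, one_mul, tsub_add_cancel_of_le]
      simpa using hj
    rw [this]
    exact I.mul_mem_left _ (hN j)
  obtain ⟨g, hg⟩ := Ideal.mem_span_range_iff_exists_fun.1 hmem
  set D := ∑ j, N j + 1
  refine ⟨fun i => homogeneousComponent D (g i), fun i => homogeneousComponent_isHomogeneous _ _,
    ?_⟩
  have hcomp : ∀ i, homogeneousComponent D (g i) * F i =
      homogeneousComponent (D + d) (g i * F i) := by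
    intro i
    let _ := gradedAlgebra (σ := σ) (R := K)
    have := DirectSum.coe_decompose_mul_of_right_mem_of_le
      (homogeneousSubmodule σ K) (n := D + d) (a := g i) (hF i) (Nat.le_add_left _ _)
    rw [Nat.add_sub_cancel] at this
    exact (decomposition.decompose'_apply (g i) D ▸
      decomposition.decompose'_apply (g i * F i) (D + d) ▸ this).symm
  rw [Finset.sum_congr rfl fun i _ => hcomp i, ← map_sum, hg]
  exact homogeneousComponent_eq_self (by simpa [← hb] using isHomogeneous_monomial (1 : K) rfl)

open MvPolynomial in
/-- Elimination theory for forms of degree `d` whose coefficients lie in a `K`-algebra `A`: having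
no common zero but the origin is an open condition on the specialization `A → K`. The witness `a`
is the determinant of the coefficients of combinations of the forms that specialize under `φ` to
the monomials of some degree. -/
theorem exists_elimination {K A σ ι : Type*} [Field K] [IsAlgClosed K] [CommRing A] [Algebra K A]
    [Fintype σ] [Fintype ι] (F : ι → MvPolynomial σ A) (d : ℕ) (hF : ∀ i, (F i).IsHomogeneous d)
    (φ : A →ₐ[K] K)
    (h0 : ∀ c : σ → K, (∀ i, eval c (map (φ : A →+* K) (F i)) = 0) → c = 0) :
    ∃ a : A, φ a ≠ 0 ∧ ∀ ψ : A →ₐ[K] K, ψ a ≠ 0 →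
      ∀ c : σ → K, (∀ i, eval c (map (ψ : A →+* K) (F i)) = 0) → c = 0 := by
  classical
  obtain ⟨D, hD⟩ := exists_homogeneous_combination (fun i => map (φ : A →+* K) (F i)) d
    (fun i => (hF i).map _) h0
  choose g hg hsum using hD
  let S : Finset (σ →₀ ℕ) := Finset.finsuppAntidiag Finset.univ (D + d)
  have hS : ∀ b, b ∈ S ↔ b.degree = D + d := fun b => by
    simp [S, Finset.mem_finsuppAntidiag, Finsupp.degree_eq_sum]
  let h : S → MvPolynomial σ A := fun b =>
    ∑ i, map (algebraMap K A) (g b ((hS _).1 b.2) i) * F i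
  have hψ : ∀ (ψ : A →ₐ[K] K) (b : S), map (ψ : A →+* K) (h b) =
      ∑ i, g b ((hS _).1 b.2) i * map (ψ : A →+* K) (F i) := by
    intro ψ b
    have hid : (ψ : A →+* K).comp (algebraMap K A) = RingHom.id K := by
      ext x; simp
    simp only [h, map_sum, map_mul, map_map, hid, map_id]
  have hhom : ∀ b : S, (h b).IsHomogeneous (D + d) := fun b =>
    IsHomogeneous.sum _ _ _ fun i _ => ((hg _ _ i).map _).mul (hF i)
  let M : Matrix S S A := fun b b' => coeff b' (h b)
  have hM : ∀ ψ : A →ₐ[K] K, ψ M.det = (Matrix.of fun b b' : S =>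
      coeff b'.1 (map (ψ : A →+* K) (h b))).det := by
    intro ψ
    rw [← AlgHom.coe_toRingHom, RingHom.map_det]
    congr 1
  refine ⟨M.det, ?_, fun ψ hne c hc => ?_⟩
  · have : (Matrix.of fun b b' : S => coeff b'.1 (map (φ : A →+* K) (h b))) = 1 := by
      ext b b'
      rw [Matrix.of_apply, hψ, hsum, coeff_monomial, Matrix.one_apply]
      exact if_congr Subtype.ext_iff.symm rfl rfl
    rw [hM, this, Matrix.det_one]
    exact one_ne_zero
  · rw [hM] at hne
    have hv := Matrix.eq_zero_of_mulVec_eq_zero hne (v := fun b : S => b.1.prod fun j e => c j ^ e)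
      (by
        ext b
        have hev : eval c (map (ψ : A →+* K) (h b)) = 0 := by
          rw [hψ, map_sum]
          exact Finset.sum_eq_zero fun i _ => by rw [map_mul, hc i, mul_zero]
        have hsub : (map (ψ : A →+* K) (h b)).support ⊆ S := fun s hs => by
          rw [hS]
          by_contra hne
          exact (mem_support_iff.1 hs) (((hhom b).map _).coeff_eq_zero hne)
        rw [eval_eq, Finset.sum_subset hsub (fun s _ hs => by
          rw [notMem_support_iff.1 hs, zero_mul])] at hev
        rw [Matrix.mulVec, dotProduct, Pi.zero_apply, ← hev, ← Finset.sum_coe_sort S]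
        rfl)
    ext j
    have hj := congrFun hv ⟨Finsupp.single j (D + d), (hS _).2 (by simp)⟩
    simp only [Finsupp.prod_single_index, pow_zero, Pi.zero_apply] at hj
    exact eq_zero_of_pow_eq_zero hj

end

section

open scoped Topology

variable {V : Type*} [AddCommGroup V] [Module ℂ V] {β : LinearMap.BilinForm ℂ V}

/-! ### The Zariski topology on isotropic frames and planes -/

theorem isOpen_zariski_basic {E : Type*} [AddCommGroup E] [Module ℂ E]
    (p : MvPolynomial (Module.Dual ℂ E) ℂ) :
    IsOpen[zariski E] {v : E | MvPolynomial.eval (fun l : Module.Dual ℂ E => l v) p ≠ 0} :=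
  TopologicalSpace.isOpen_generateFrom_of_mem ⟨p, rfl⟩

theorem continuous_zariski_iff {X E : Type*} [TopologicalSpace X] [AddCommGroup E] [Module ℂ E]
    (f : X → E) : Continuous[_, zariski E] f ↔ ∀ p : MvPolynomial (Module.Dual ℂ E) ℂ,
      IsOpen {x | MvPolynomial.eval (fun l : Module.Dual ℂ E => l (f x)) p ≠ 0} := by
  rw [continuous_generateFrom_iff]
  constructor
  · exact fun h p => h _ ⟨p, rfl⟩
  · rintro h _ ⟨p, rfl⟩
    exact h p

theorem continuous_zariski_linearMap {E F : Type*} [AddCommGroup E] [Module ℂ E] [AddCommGroup F]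
    [Module ℂ F] (f : E →ₗ[ℂ] F) : Continuous[zariski E, zariski F] f := by
  let _ := zariski E
  rw [continuous_zariski_iff]
  intro p
  have := isOpen_zariski_basic (E := E) (MvPolynomial.rename (fun l => l ∘ₗ f) p)
  simp only [MvPolynomial.eval_rename] at this
  exact this

/-- A quadratic curve in a vector space is continuous in the Zariski topology: a polynomial in one
variable has finitely many zeros, or vanishes identically. -/
theorem continuous_zariski_quadratic {E : Type*} [AddCommGroup E] [Module ℂ E] (u v w : E) :
    Continuous[_, zariski E] fun t : CofiniteTopology ℂ =>
      u + (CofiniteTopology.of.symm t) • v + (CofiniteTopology.of.symm t) ^ 2 • w := by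
  rw [continuous_zariski_iff]
  intro p
  let P : Polynomial ℂ := MvPolynomial.aeval (fun l : Module.Dual ℂ E =>
    Polynomial.C (l u) + Polynomial.X * Polynomial.C (l v) +
      Polynomial.X ^ 2 * Polynomial.C (l w)) p
  have hP : ∀ t : ℂ, P.eval t =
      MvPolynomial.eval (fun l : Module.Dual ℂ E => l (u + t • v + t ^ 2 • w)) p := by
    intro t
    rw [← Polynomial.coe_evalRingHom, ← MvPolynomial.coe_aeval_eq_eval]
    change ((Polynomial.aeval t : Polynomial ℂ →ₐ[ℂ] ℂ).comp (MvPolynomial.aeval _)) p = _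
    rw [MvPolynomial.comp_aeval]
    simp [mul_comm t, mul_comm (t ^ 2)]
  simp only [← hP]
  rw [CofiniteTopology.isOpen_iff']
  rcases eq_or_ne P 0 with h0 | h0
  · simp [h0]
  · right
    refine ((Polynomial.finite_setOfPred_isRoot h0).preimage
      (CofiniteTopology.of.symm.injective.injOn)).subset fun t ht => ?_
    simpa using ht

theorem continuous_isoFrames_iff {X : Type*} [TopologicalSpace X] {k : ℕ} (f : X → IsoFrames β k) :
    Continuous f ↔ Continuous[_, zariski (Fin k → V)] fun x => (f x).1 :=
  let _ := zariski (Fin k → V)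
  continuous_induced_rng

theorem continuous_toPlane {k : ℕ} : Continuous (IsoFrames.toPlane : IsoFrames β k → _) :=
  continuous_coinduced_rng

theorem toPlane_surjective [FiniteDimensional ℂ V] {k : ℕ} (K : IsoPlanes β k) :
    ∃ v : IsoFrames β k, v.toPlane = K := by
  let b := Module.finBasisOfFinrankEq ℂ K.1 K.2.2
  have hspan : Submodule.span ℂ (Set.range (K.1.subtype ∘ b)) = K.1 := by
    rw [Set.range_comp, Submodule.span_image, b.span_eq, Submodule.map_top, Submodule.range_subtype]
  exact ⟨⟨K.1.subtype ∘ b, b.linearIndependent.map' _ (Submodule.ker_subtype _),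
    hspan.symm ▸ K.2.1⟩, Subtype.ext hspan⟩

/-- The set of isotropic planes that meet the common zero locus of the forms `cutForm e i`, `i ∈ I`,
only at the origin is open, by elimination. -/
theorem isOpen_forall_cutForm {n : ℕ} (e : Module.Basis (Set.Icc (-(n : ℤ)) (n : ℤ)) ℂ V)
    (I : Finset ℤ) (k : ℕ) :
    IsOpen {K : IsoPlanes β k | ∀ x ∈ K.1, (∀ i ∈ I, cutForm e i x = 0) → x = 0} := by
  refine isOpen_coinduced.2 (isOpen_iff_forall_mem_open.2 fun v hv => ?_)
  let A := MvPolynomial (Module.Dual ℂ (Fin k → V)) ℂ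
  let Q : I → Fin k → Fin k → A := fun i s t => ∑ l ∈ Finset.Icc i.1 (n : ℤ),
    MvPolynomial.X (coordAt e l ∘ₗ LinearMap.proj s) *
      MvPolynomial.X (coordAt e (-l) ∘ₗ LinearMap.proj t)
  let F : I → MvPolynomial (Fin k) A := fun i =>
    ∑ s, ∑ t, MvPolynomial.C (Q i s t) * (MvPolynomial.X s * MvPolynomial.X t)
  have hF : ∀ i, (F i).IsHomogeneous 2 := fun i =>
    MvPolynomial.IsHomogeneous.sum _ _ _ fun s _ => MvPolynomial.IsHomogeneous.sum _ _ _ fun t _ =>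
      ((MvPolynomial.isHomogeneous_X _ s).mul (MvPolynomial.isHomogeneous_X _ t)).C_mul _
  let ψ : (Fin k → V) → A →ₐ[ℂ] ℂ := fun w => MvPolynomial.aeval fun l => l w
  have hψ : ∀ w c i, MvPolynomial.eval c (MvPolynomial.map (ψ w : A →+* ℂ) (F i)) =
      cutForm e i (∑ t, c t • w t) := by
    intro w c i
    have hX : ∀ l : Module.Dual ℂ (Fin k → V), ψ w (MvPolynomial.X l) = l w :=
      fun l => MvPolynomial.aeval_X _ l
    have hQ : ∀ s t, ψ w (Q i s t) = ∑ l ∈ Finset.Icc i.1 (n : ℤ),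
        coordAt e l (w s) * coordAt e (-l) (w t) := by
      intro s t
      simp only [Q, map_sum, map_mul, hX]
      rfl
    simp only [F, map_sum, map_mul, MvPolynomial.map_C, MvPolynomial.map_X,
      MvPolynomial.eval_C, MvPolynomial.eval_X, RingHom.coe_coe, hQ]
    simp only [cutForm, map_sum, map_smul, smul_eq_mul, Finset.sum_mul_sum]
    symm
    rw [Finset.sum_comm]
    refine Finset.sum_congr rfl fun s _ => ?_
    rw [Finset.sum_comm]
    refine Finset.sum_congr rfl fun t _ => ?_
    rw [Finset.sum_mul]
    refine Finset.sum_congr rfl fun l _ => ?_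
    ring
  have hiff : ∀ w : IsoFrames β k, (∀ x ∈ w.toPlane.1, (∀ i ∈ I, cutForm e i x = 0) → x = 0) ↔
      ∀ c : Fin k → ℂ, (∀ i, MvPolynomial.eval c (MvPolynomial.map (ψ w.1 : A →+* ℂ) (F i)) = 0) →
        c = 0 := by
    intro w
    simp only [hψ]
    constructor
    · intro h c hc
      exact funext (Fintype.linearIndependent_iff.1 w.2.1 c
        (h _ ((Submodule.mem_span_range_iff_exists_fun ℂ).2 ⟨c, rfl⟩) fun i hi => hc ⟨i, hi⟩))
    · intro h x hx hq
      obtain ⟨c, rfl⟩ := (Submodule.mem_span_range_iff_exists_fun ℂ).1 hx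
      simp [h c fun i => hq i i.2]
  obtain ⟨a, ha, hall⟩ := exists_elimination F 2 hF (ψ v.1) ((hiff v).1 hv)
  refine ⟨Subtype.val ⁻¹' {w | ψ w a ≠ 0}, fun w hw => (hiff w).2 (hall _ hw), ?_, ha⟩
  exact ⟨_, isOpen_zariski_basic a, rfl⟩

/-! ### Siegel transformations -/

/-- The Siegel (or Eichler) transformation of an isotropic vector `a` and a vector `b ⊥ a`, a
unipotent isometry. -/
noncomputable def siegel (β : LinearMap.BilinForm ℂ V) (a b : V) : V →ₗ[ℂ] V :=
  LinearMap.id + (β.flip a).smulRight b - (β.flip b).smulRight a -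
    (β.flip a).smulRight ((β b b / 2) • a)

theorem siegel_apply (a b x : V) :
    siegel β a b x = x + β x a • b - β x b • a - (β x a * (β b b / 2)) • a := by
  simp [siegel, smul_smul]

theorem siegel_isometry (hs : ∀ x y, β x y = β y x) {a b : V} (ha : β a a = 0) (hab : β a b = 0)
    (x y : V) : β (siegel β a b x) (siegel β a b y) = β x y := by
  simp only [siegel_apply, map_add, map_sub, map_smul, LinearMap.add_apply, LinearMap.sub_apply,
    LinearMap.smul_apply, smul_eq_mul, ha, hab, hs b a, hs a y, hs b y]
  ring

theorem siegel_injective (hs : ∀ x y, β x y = β y x) (hnd : β.Nondegenerate) {a b : V}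
    (ha : β a a = 0) (hab : β a b = 0) : Function.Injective (siegel β a b) := by
  rw [injective_iff_map_eq_zero]
  intro x hx
  refine hnd.1 x fun y => ?_
  rw [← siegel_isometry hs ha hab, hx, map_zero, LinearMap.zero_apply]

/-- The frame moved by a linear isometry. -/
def IsoFrames.map {k : ℕ} (g : V →ₗ[ℂ] V) (hg : Function.Injective g)
    (hβ : ∀ x y, β (g x) (g y) = β x y) (v : IsoFrames β k) : IsoFrames β k :=
  ⟨g ∘ v.1, v.2.1.map' g (LinearMap.ker_eq_bot.2 hg), by
    rw [Set.range_comp, Submodule.span_image]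
    rintro _ ⟨x, hx, rfl⟩ _ ⟨y, hy, rfl⟩
    rw [hβ]
    exact v.2.2 x hx y hy⟩

/-- The plane moved by a linear isometry. -/
def IsoPlanes.map {k : ℕ} (g : V →ₗ[ℂ] V) (hg : Function.Injective g)
    (hβ : ∀ x y, β (g x) (g y) = β x y) (K : IsoPlanes β k) : IsoPlanes β k :=
  ⟨K.1.map g, by
    rintro _ ⟨x, hx, rfl⟩ _ ⟨y, hy, rfl⟩
    rw [hβ]
    exact K.2.1 x hx y hy, (Submodule.equivMapOfInjective g hg K.1).finrank_eq.symm.trans K.2.2⟩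

theorem IsoFrames.toPlane_map {k : ℕ} (g : V →ₗ[ℂ] V) (hg : Function.Injective g)
    (hβ : ∀ x y, β (g x) (g y) = β x y) (v : IsoFrames β k) :
    (v.map g hg hβ).toPlane = v.toPlane.map g hg hβ := by
  refine Subtype.ext ?_
  change Submodule.span ℂ (Set.range (g ∘ v.1)) = (Submodule.span ℂ (Set.range v.1)).map g
  rw [Set.range_comp, Submodule.span_image]

theorem IsoPlanes.continuous_map {k : ℕ} (g : V →ₗ[ℂ] V) (hg : Function.Injective g)
    (hβ : ∀ x y, β (g x) (g y) = β x y) :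
    Continuous (IsoPlanes.map g hg hβ : IsoPlanes β k → IsoPlanes β k) := by
  refine continuous_coinduced_dom.2 ?_
  have : IsoPlanes.map g hg hβ ∘ IsoFrames.toPlane =
      (IsoFrames.toPlane ∘ IsoFrames.map g hg hβ : IsoFrames β k → _) :=
    funext fun v => (v.toPlane_map g hg hβ).symm
  rw [this]
  refine continuous_toPlane.comp ((continuous_isoFrames_iff _).2 ?_)
  let _ := zariski (Fin k → V)
  exact (continuous_zariski_linearMap (LinearMap.compLeft g (Fin k))).comp continuous_induced_dom

/-- Moving along the curve of Siegel transformations with parameters `a, t b` shows that the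
closure of an open set of isotropic planes is stable under Siegel transformations. -/
theorem closure_stable_siegel [FiniteDimensional ℂ V] (hs : ∀ x y, β x y = β y x)
    (hnd : β.Nondegenerate) {k : ℕ} {U : Set (IsoPlanes β k)} (hU : IsOpen U) {a b : V}
    (ha : β a a = 0) (hab : β a b = 0)
    {K : IsoPlanes β k} (hK : K ∈ closure U) :
    K.map (siegel β a b) (siegel_injective hs hnd ha hab) (siegel_isometry hs ha hab) ∈
      closure U := by
  suffices hmaps : Set.MapsTo (IsoPlanes.map (siegel β a b) (siegel_injective hs hnd ha hab)
      (siegel_isometry hs ha hab)) U (closure U) from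
    closure_closure (s := U) ▸ hmaps.closure (IsoPlanes.continuous_map _ _ _) hK
  intro L hL
  obtain ⟨v, rfl⟩ := toPlane_surjective L
  have hab' : ∀ t : ℂ, β a (t • b) = 0 := fun t => by rw [map_smul, hab, smul_zero]
  let γ : CofiniteTopology ℂ → IsoPlanes β k := fun t =>
    (v.map (siegel β a (CofiniteTopology.of.symm t • b))
      (siegel_injective hs hnd ha (hab' _)) (siegel_isometry hs ha (hab' _))).toPlane
  have hγ : Continuous γ := by
    refine continuous_toPlane.comp ((continuous_isoFrames_iff _).2 ?_)
    convert continuous_zariski_quadratic v.1 (fun i => β (v.1 i) a • b - β (v.1 i) b • a)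
      (fun i => -(β (v.1 i) a * (β b b / 2)) • a) using 2 with t
    ext i
    simp only [IsoFrames.map, Function.comp_apply, siegel_apply, map_smul, LinearMap.smul_apply,
      smul_eq_mul, Pi.add_apply, Pi.smul_apply]
    module
  rw [mem_closure_iff]
  intro W hW hmem
  have h0 : (γ ⁻¹' U).Nonempty := ⟨CofiniteTopology.of 0, by
    have : γ (CofiniteTopology.of 0) = v.toPlane := by
      have h : siegel β a ((0 : ℂ) • b) = LinearMap.id := by
        ext x
        simp [siegel_apply]
      simp only [γ, Equiv.symm_apply_apply, IsoFrames.toPlane_map]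
      refine Subtype.ext ?_
      simp only [IsoPlanes.map, h, Submodule.map_id]
    rwa [Set.mem_preimage, this]⟩
  have h1 : (γ ⁻¹' W).Nonempty := ⟨CofiniteTopology.of 1, by
    have : γ (CofiniteTopology.of 1) = v.toPlane.map (siegel β a b)
        (siegel_injective hs hnd ha hab) (siegel_isometry hs ha hab) := by
      simp only [γ, Equiv.symm_apply_apply, IsoFrames.toPlane_map]
      refine Subtype.ext ?_
      simp only [IsoPlanes.map, one_smul]
    rwa [Set.mem_preimage, this]⟩
  have f0 := CofiniteTopology.isOpen_iff.1 (hU.preimage hγ) h0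
  have f1 := CofiniteTopology.isOpen_iff.1 (hW.preimage hγ) h1
  have : Infinite (CofiniteTopology ℂ) := CofiniteTopology.of.infinite_iff.1 inferInstance
  obtain ⟨t, ht⟩ := (f0.union f1).infinite_compl.nonempty
  rw [Set.compl_union, compl_compl, compl_compl] at ht
  exact ⟨γ t, ht.2, ht.1⟩

end

section

variable {V : Type*} [AddCommGroup V] [Module ℂ V] {β : LinearMap.BilinForm ℂ V}

/-! ### Transitivity of the Siegel transformations -/

theorem map_siegel_sup_span {A : Submodule ℂ V} {a b : V} (hAa : ∀ x ∈ A, β x a = 0)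
    (hAb : ∀ x ∈ A, β x b = 0) (u : V) :
    (A ⊔ Submodule.span ℂ {u}).map (siegel β a b) = A ⊔ Submodule.span ℂ {siegel β a b u} := by
  have hfix : ∀ x ∈ A, siegel β a b x = x := by
    intro x hx
    rw [siegel_apply, hAa x hx, hAb x hx]
    simp
  have hA : A.map (siegel β a b) = A := by
    ext x
    constructor
    · rintro ⟨y, hy, rfl⟩
      rwa [hfix y hy]
    · exact fun hx => ⟨x, hx, hfix x hx⟩
  rw [Submodule.map_sup, Submodule.map_span, Set.image_singleton, hA]

/-- A set of subspaces is stable under Siegel transformations. -/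
def SiegelStable (β : LinearMap.BilinForm ℂ V) (T : Set (Submodule ℂ V)) : Prop :=
  ∀ a b, β a a = 0 → β a b = 0 → ∀ K ∈ T, K.map (siegel β a b) ∈ T

/-- Two isotropic planes `A ⊕ ⟨u⟩` and `A ⊕ ⟨w⟩` with `β u w ≠ 0` are related by Siegel
transformations: two of them, built from a vector `x` orthogonal to `A`, `u` and `w`, move `u` to a
multiple of `w` and fix `A`. -/
theorem SiegelStable.mem_of_apply_ne_zero {T : Set (Submodule ℂ V)} (hT : SiegelStable β T)
    (hs : ∀ x y, β x y = β y x) {A : Submodule ℂ V} {u w x : V}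
    (hAu : ∀ y ∈ A, β y u = 0) (hAw : ∀ y ∈ A, β y w = 0) (hAx : ∀ y ∈ A, β y x = 0)
    (huu : β u u = 0) (hww : β w w = 0) (huw : β u w ≠ 0) (hux : β u x = 0) (hwx : β w x = 0)
    (hxx : β x x ≠ 0) (hu : A ⊔ Submodule.span ℂ {u} ∈ T) : A ⊔ Submodule.span ℂ {w} ∈ T := by
  set r := β x x with hr
  -- Rescaled so that `β u w' = 1`; the factor `2 / r` below cancels the `x`-component of the image.
  set w' := (β u w)⁻¹ • w with hw'
  have huw' : β u w' = 1 := by rw [hw', map_smul, smul_eq_mul, inv_mul_cancel₀ huw]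
  have hww' : β w' w' = 0 := by simp [hw', hww]
  have hwx' : β w' x = 0 := by simp [hw', hwx]
  have hAw' : ∀ y ∈ A, β y w' = 0 := fun y hy => by rw [hw', map_smul, hAw y hy, smul_zero]
  have h1 := hT w' x hww' hwx' _ hu
  rw [map_siegel_sup_span hAw' hAx, siegel_apply, huw', hux] at h1
  have h2 := hT u ((2 / r) • x) huu (by rw [map_smul, hux, smul_zero]) _ h1
  rw [map_siegel_sup_span hAu (fun y hy => by rw [map_smul, hAx y hy, smul_zero])] at h2
  have hval : siegel β u ((2 / r) • x) (u + (1 : ℂ) • x - (0 : ℂ) • w' - (1 * (r / 2)) • w') =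
      (-(r / 2) * (β u w)⁻¹) • w := by
    rw [siegel_apply]
    simp only [map_add, map_sub, map_smul, LinearMap.add_apply, LinearMap.sub_apply,
      LinearMap.smul_apply, smul_eq_mul, huu, hux, hwx', ← hr, hs x u, hs w' u, huw']
    rw [mul_smul (-(r / 2)), ← hw']
    match_scalars <;> field_simp <;> ring
  rw [hval, Submodule.span_singleton_smul_eq] at h2
  · exact h2
  · exact (mul_ne_zero (neg_ne_zero.2 (div_ne_zero hxx two_ne_zero)) (inv_ne_zero huw)).isUnit

theorem exists_orthogonal_apply_eq_one [FiniteDimensional ℂ V] (hs : ∀ x y, β x y = β y x)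
    (hnd : β.Nondegenerate) {W : Submodule ℂ V} {u : V} (hu : u ∉ W) :
    ∃ b, (∀ x ∈ W, β x b = 0) ∧ β u b = 1 := by
  rw [← LinearMap.BilinForm.orthogonal_orthogonal hnd
    (LinearMap.BilinForm.isSymm_def.2 hs).isRefl W] at hu
  simp only [LinearMap.BilinForm.mem_orthogonal_iff (B := β) (N := β.orthogonal W), not_forall]
    at hu
  obtain ⟨b, hb, hbu⟩ := hu
  have hbu' : β u b ≠ 0 := fun h => hbu ((hs b u).trans h)
  refine ⟨(β u b)⁻¹ • b, fun x hx => ?_, ?_⟩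
  · rw [map_smul, hb x hx, smul_zero]
  · rw [map_smul, smul_eq_mul, inv_mul_cancel₀ hbu']

/-- Two isotropic planes `A ⊕ ⟨u⟩` and `A ⊕ ⟨w⟩` with `β u w = 0` are related by Siegel
transformations that fix `A` and move `u` to `u - w` and then to `-w`. -/
theorem SiegelStable.mem_of_apply_eq_zero [FiniteDimensional ℂ V] {T : Set (Submodule ℂ V)}
    (hT : SiegelStable β T) (hs : ∀ x y, β x y = β y x) (hnd : β.Nondegenerate)
    {A : Submodule ℂ V} {u w : V} (hAu : ∀ y ∈ A, β y u = 0) (hAw : ∀ y ∈ A, β y w = 0)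
    (huu : β u u = 0) (hww : β w w = 0) (huw : β u w = 0) (hunot : u ∉ A)
    (hwnot : w ∉ A ⊔ Submodule.span ℂ {u}) (hu : A ⊔ Submodule.span ℂ {u} ∈ T) :
    A ⊔ Submodule.span ℂ {w} ∈ T := by
  have hunot' : u ∉ A ⊔ Submodule.span ℂ {w} := by
    intro h
    obtain ⟨y, hy, z, hz, hyz⟩ := Submodule.mem_sup.1 h
    obtain ⟨c, rfl⟩ := Submodule.mem_span_singleton.1 hz
    have hc : c ≠ 0 := by
      rintro rfl
      rw [zero_smul, add_zero] at hyz
      exact hunot (hyz ▸ hy)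
    refine hwnot ?_
    have : w = (-c⁻¹) • y + c⁻¹ • u := by
      rw [← hyz, smul_add, smul_smul, inv_mul_cancel₀ hc]
      module
    rw [this]
    exact Submodule.add_mem_sup (A.smul_mem _ hy)
      (Submodule.smul_mem _ _ (Submodule.mem_span_singleton_self u))
  have hself : ∀ z : V, z ∈ A ⊔ Submodule.span ℂ {z} := fun z =>
    Submodule.mem_sup_right (Submodule.mem_span_singleton_self z)
  have hleft : ∀ z : V, A ≤ A ⊔ Submodule.span ℂ {z} := fun z => le_sup_left
  obtain ⟨b, hb, hub⟩ := exists_orthogonal_apply_eq_one hs hnd hunot'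
  obtain ⟨b', hb', hwb'⟩ := exists_orthogonal_apply_eq_one hs hnd hwnot
  have h1 := hT w b hww (hb w (hself w)) _ hu
  rw [map_siegel_sup_span hAw (fun y hy => hb y (hleft w hy))] at h1
  have h2 := hT u (-b') huu (by rw [map_neg, hb' u (hself u), neg_zero]) _ h1
  rw [map_siegel_sup_span hAu (fun y hy => by rw [map_neg, hb' y (hleft u hy), neg_zero])] at h2
  have hval : siegel β u (-b') (siegel β w b u) = (-1 : ℂ) • w := by
    have : siegel β w b u = u - w := by
      rw [siegel_apply, huw, hub]
      simp
    rw [this, siegel_apply]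
    simp [huu, hs w u, huw, hb' u (hself u), hwb']
  rw [hval, Submodule.span_singleton_smul_eq isUnit_one.neg] at h2
  exact h2

theorem two_mul_finrank_le [FiniteDimensional ℂ V] (hnd : β.Nondegenerate) {H : Submodule ℂ V}
    (hH : IsIsotropic β H) : 2 * Module.finrank ℂ H ≤ Module.finrank ℂ V := by
  have hle : H ≤ β.orthogonal H := fun y hy x hx => hH x hx y hy
  have := Submodule.finrank_mono hle
  rw [LinearMap.BilinForm.finrank_orthogonal hnd] at this
  have := Submodule.finrank_le H
  omega

/-- In odd dimension, a space spanned by an isotropic `A ⊕ ⟨u⟩` and a vector `w` with `β u w ≠ 0`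
has an anisotropic orthogonal vector: otherwise its orthogonal space together with `u` would be an
isotropic space of more than half the dimension. -/
theorem exists_orthogonal_apply_self_ne_zero [FiniteDimensional ℂ V]
    (hs : ∀ x y, β x y = β y x) (hnd : β.Nondegenerate) (hodd : Odd (Module.finrank ℂ V))
    {A : Submodule ℂ V} {u w : V} (hK : IsIsotropic β (A ⊔ Submodule.span ℂ {u}))
    (huw : β u w ≠ 0) :
    ∃ x, (∀ y ∈ A, β y x = 0) ∧ β u x = 0 ∧ β w x = 0 ∧ β x x ≠ 0 := by
  set K := A ⊔ Submodule.span ℂ {u} with hKdef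
  set P := β.orthogonal (K ⊔ Submodule.span ℂ {w}) with hP
  have huK : u ∈ K := Submodule.mem_sup_right (Submodule.mem_span_singleton_self u)
  have hPK : ∀ x ∈ P, ∀ y ∈ K, β y x = 0 := fun x hx y hy => hx y (Submodule.mem_sup_left hy)
  have hPw : ∀ x ∈ P, β w x = 0 := fun x hx =>
    hx w (Submodule.mem_sup_right (Submodule.mem_span_singleton_self w))
  by_contra! hcon
  have hPself : ∀ x ∈ P, β x x = 0 := fun x hx =>
    hcon x (fun y hy => hPK x hx y (Submodule.mem_sup_left hy)) (hPK x hx u huK) (hPw x hx)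
  have hisoP : IsIsotropic β (P ⊔ Submodule.span ℂ {u}) := by
    refine isIsotropic_of_apply_self hs fun z hz => ?_
    obtain ⟨x, hx, y, hy, rfl⟩ := Submodule.mem_sup.1 hz
    obtain ⟨c, rfl⟩ := Submodule.mem_span_singleton.1 hy
    simp [hPself x hx, hs x u, hPK x hx u huK, hK u huK u huK]
  have huP : u ∉ P := fun h => huw ((hs u w).trans (hPw u h))
  have hlt : Module.finrank ℂ P < Module.finrank ℂ (P ⊔ Submodule.span ℂ {u} : Submodule ℂ V) :=
    Submodule.finrank_lt_finrank_of_lt (lt_of_le_of_ne le_sup_left fun h =>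
      huP (h ▸ Submodule.mem_sup_right (Submodule.mem_span_singleton_self u)))
  have h1 := two_mul_finrank_le hnd hisoP
  have h2 := two_mul_finrank_le hnd hK
  have h3 : Module.finrank ℂ P = _ := LinearMap.BilinForm.finrank_orthogonal hnd _
  have h4 : Module.finrank ℂ (K ⊔ Submodule.span ℂ {w} : Submodule ℂ V) ≤
      Module.finrank ℂ K + Module.finrank ℂ (Submodule.span ℂ {w}) :=
    Submodule.finrank_add_le_finrank_add_finrank _ _
  have h5 : Module.finrank ℂ (Submodule.span ℂ {w}) = 1 :=
    finrank_span_singleton fun h => huw (by rw [h, map_zero])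
  obtain ⟨q, hq⟩ := hodd
  omega

/-- The Siegel transformations act transitively on isotropic planes of a given dimension. Planes
are moved to planes with a common hyperplane, increasing the intersection with the target. -/
theorem SiegelStable.mem_of_mem [FiniteDimensional ℂ V] {T : Set (Submodule ℂ V)}
    (hT : SiegelStable β T) (hs : ∀ x y, β x y = β y x) (hnd : β.Nondegenerate)
    (hodd : Odd (Module.finrank ℂ V)) {k : ℕ}
    (hTk : ∀ K ∈ T, IsIsotropic β K ∧ Module.finrank ℂ K = k) {K L : Submodule ℂ V} (hK : K ∈ T)
    (hL : IsIsotropic β L) (hLk : Module.finrank ℂ L = k) : L ∈ T := by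
  induction hd : k - Module.finrank ℂ (K ⊓ L : Submodule ℂ V) using Nat.strong_induction_on
    generalizing K with
  | _ d ih =>
  obtain ⟨hKiso, hKk⟩ := hTk K hK
  by_cases hLK : L ≤ K
  · rwa [Submodule.eq_of_le_of_finrank_eq hLK (hLk.trans hKk.symm)]
  obtain ⟨w, hwL, hwK⟩ := Set.not_subset.1 hLK
  have hKL : ¬ K ≤ L := fun h => hLK (Submodule.eq_of_le_of_finrank_eq h (hKk.trans hLk.symm)).ge
  -- The hyperplane of `K` orthogonal to `b` contains `K ⊓ L` and is orthogonal to `w`.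
  obtain ⟨b, hb, ⟨u, huK, hub⟩, hbw⟩ : ∃ b, (∀ x ∈ K ⊓ L, β x b = 0) ∧ (∃ u ∈ K, β u b ≠ 0) ∧
      ∀ x ∈ K, β x b = 0 → β x w = 0 := by
    by_cases hKw : ∀ x ∈ K, β x w = 0
    · obtain ⟨u, huK, huL⟩ := Set.not_subset.1 hKL
      obtain ⟨b, hb, hub⟩ := exists_orthogonal_apply_eq_one hs hnd
        (W := K ⊓ L) (u := u) (fun h => huL h.2)
      exact ⟨b, hb, ⟨u, huK, hub ▸ one_ne_zero⟩, fun x hx _ => hKw x hx⟩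
    · push Not at hKw
      exact ⟨w, fun x hx => hL x hx.2 w hwL, hKw, fun _ _ h => h⟩
  set A := K ⊓ LinearMap.ker (β.flip b) with hA
  have hAb : ∀ x ∈ A, β x b = 0 := fun x hx => hx.2
  have hAu : ∀ x ∈ A, β x u = 0 := fun x hx => hKiso x hx.1 u huK
  have hAw : ∀ x ∈ A, β x w = 0 := fun x hx => hbw x hx.1 (hAb x hx)
  have hKA : A ⊔ Submodule.span ℂ {u} = K := by
    refine le_antisymm (sup_le inf_le_left ((Submodule.span_singleton_le_iff_mem _ _).2 huK))
      fun x hx => ?_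
    refine Submodule.mem_sup.2 ⟨x - (β x b / β u b) • u, ⟨K.sub_mem hx (K.smul_mem _ huK), ?_⟩,
      (β x b / β u b) • u, Submodule.smul_mem _ _ (Submodule.mem_span_singleton_self u),
      sub_add_cancel _ _⟩
    change β (x - (β x b / β u b) • u) b = 0
    rw [map_sub, LinearMap.sub_apply, map_smul, LinearMap.smul_apply, smul_eq_mul,
      div_mul_cancel₀ _ hub, sub_self]
  have hmem : A ⊔ Submodule.span ℂ {w} ∈ T := by
    have hww := hL w hwL w hwL
    have huu := hKiso u huK u huK
    by_cases huw : β u w = 0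
    · exact hT.mem_of_apply_eq_zero hs hnd hAu hAw huu hww huw (fun h => hub (hAb u h))
        (hKA.symm ▸ hwK) (hKA.symm ▸ hK)
    · obtain ⟨x, hAx, hux, hwx, hxx⟩ :=
        exists_orthogonal_apply_self_ne_zero hs hnd hodd (hKA.symm ▸ hKiso) huw
      exact hT.mem_of_apply_ne_zero hs hAu hAw hAx huu hww huw hux hwx hxx (hKA.symm ▸ hK)
  refine ih _ ?_ hmem rfl
  have hwmem : w ∈ (A ⊔ Submodule.span ℂ {w}) ⊓ L :=
    ⟨Submodule.mem_sup_right (Submodule.mem_span_singleton_self w), hwL⟩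
  have hlt : K ⊓ L < (A ⊔ Submodule.span ℂ {w}) ⊓ L := by
    refine lt_of_le_of_ne (fun x hx => ⟨Submodule.mem_sup_left ⟨hx.1, hb x hx⟩, hx.2⟩) fun h => ?_
    exact hwK (h.symm ▸ hwmem : w ∈ K ⊓ L).1
  have h1 := Submodule.finrank_lt_finrank_of_lt hlt
  have h2 : Module.finrank ℂ ((A ⊔ Submodule.span ℂ {w}) ⊓ L : Submodule ℂ V) ≤ k :=
    hLk ▸ Submodule.finrank_mono inf_le_right
  omega

/-- The variety of isotropic `k`-planes in an odd-dimensional space is irreducible. -/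
theorem dense_of_isOpen [FiniteDimensional ℂ V] (hs : ∀ x y, β x y = β y x)
    (hnd : β.Nondegenerate) (hodd : Odd (Module.finrank ℂ V)) {k : ℕ} {U : Set (IsoPlanes β k)}
    (hU : IsOpen U) (hne : U.Nonempty) : Dense U := by
  obtain ⟨K, hK⟩ := hne
  let T : Set (Submodule ℂ V) := (fun L : IsoPlanes β k => L.1) '' closure U
  have hT : SiegelStable β T := by
    rintro a b ha hab _ ⟨L, hL, rfl⟩
    exact ⟨_, closure_stable_siegel hs hnd hU ha hab hL, rfl⟩
  intro L
  obtain ⟨L', hL', heq⟩ := hT.mem_of_mem hs hnd hodd (by rintro _ ⟨M, _, rfl⟩; exact M.2)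
    ⟨K, subset_closure hK, rfl⟩ L.2.1 L.2.2
  exact Subtype.ext heq ▸ hL'

end

end OrthGrass

theorem theorem2 {V : Type*} [AddCommGroup V] [Module ℂ V] (n k m : ℕ)
    (β : LinearMap.BilinForm ℂ V)
    (e : Module.Basis (Set.Icc (-(n : ℤ)) (n : ℤ)) ℂ V)
    (he : OrthGrass.IsStandardBasis β e)
    (mu lam : OrthGrass.SY n) (hm : mu.size + (m : ℤ) = lam.size) (hk : k + m = n + 1) :
    OrthGrass.ForGeneralIsoPlane β k (fun K =>
      (OrthGrass.schubert β e mu ∩ OrthGrass.schubertOppCompl β e lam ∩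
          OrthGrass.specialSchubert n β K).Nonempty →
        mu ≤ lam ∧ OrthGrass.IsSkewRow lam mu) := by
  have : FiniteDimensional ℂ V := Module.Finite.of_basis e
  have hodd : Odd (Module.finrank ℂ V) := by
    rw [Module.finrank_eq_card_basis e, Fintype.card_ofFinset, Int.card_Icc]
    exact ⟨n, by omega⟩
  by_cases hle : ∀ j, mu j ≤ lam j
  · by_cases hrow : OrthGrass.IsSkewRow lam mu
    · exact ⟨Set.univ, isOpen_univ, dense_univ, fun _ _ _ => ⟨hle, hrow⟩⟩
    · obtain ⟨v, hv⟩ := OrthGrass.exists_isoFrame_forall_cutForm he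
        (Finset.filter_subset _ _) (OrthGrass.le_card_cuts hm hk hle hrow)
      have hopen := OrthGrass.isOpen_forall_cutForm (β := β) e (OrthGrass.cuts lam mu) k
      refine ⟨_, hopen, OrthGrass.dense_of_isOpen he.symm he.nondegenerate hodd hopen
        ⟨v.toPlane, hv⟩, ?_⟩
      rintro K hK ⟨H, ⟨h1, h2⟩, -, hne⟩
      obtain ⟨x, hx, hx0⟩ := Submodule.exists_mem_ne_zero_of_ne_bot hne
      exact absurd (hK x hx.2 fun i hi =>
        OrthGrass.cutForm_eq_zero_of_mem_schubert he h1 h2 hi hx.1) hx0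
  · refine ⟨Set.univ, isOpen_univ, dense_univ, ?_⟩
    rintro K - ⟨H, ⟨h1, h2⟩, -⟩
    exact absurd (OrthGrass.le_of_mem_schubert h1 h2) hle
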